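/- Let $k$ be an algebraically closed field of characteristic $0$. A Kronecker–Weierstrass block over a polynomial ring $S=k[x_1,\dots,x_n]$ is a matrix of one of the following types, whose entries are built from linear forms of $S$: a nilpotent block of length $m\ge 1$, $$\begin{pmatrix}0&u_1&\cdots&u_{m-2}&u_{m-1}\\u_1&u_2&\cdots&u_{m-1}&0\end{pmatrix};$$ a scroll block of length $s\ge 0$, $$\begin{pmatrix}y_1&y_2&\cdots&y_s\\y_2&y_3&\cdots&y_{s+1}\end{pmatrix}$$ (for $s=0$ it has no column and consists of one form $y_1$, which does not occur in the matrix); a Jordan block of length $p\ge 1$ with eigenvalue $\lambda\in k$, $$\begin{pmatrix}z_1&\cdots&z_{p-1}&z_p\\z_2+\lambda z_1&\cdots&z_p+\lambda z_{p-1}&\lambda z_p\end{pmatrix}.$$ A Kronecker–Weierstrass matrix over $S$ is a concatenation of such blocks in which the forms $u,y,z$ of all the blocks together are a $k$-basis of the space $S_1$ of linear forms. A Kronecker–Weierstrass normal form of a $2\times e$ matrix $Y$ of linear forms of $S$ is a Kronecker–Weierstrass matrix of the form $PYC$ with $P\in \mathrm{GL}_2(k)$, $C\in\mathrm{GL}_e(k)$.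 The determinantal ring of $Y$ is $S/I_2(Y)$, where $I_2(Y)$ is the ideal generated by the $2$-minors of $Y$. Let $X$ be a $2\times e$ Kronecker–Weierstrass matrix over $S=k[x_1,\dots,x_n]$, let $R=S/I_2(X)$ be its determinantal ring, and let $R'=R/(l_1,\dots,l_r)$, where $l_1,\dots,l_r$ are linear forms. Then there are an integer $n'\ge 0$ and a surjective $k$-algebra homomorphism $\varphi:S\to S'=k[x_1,\dots,x_{n'}]$ which maps linear forms to linear forms and has kernel $(l_1,\dots,l_r)$ (the elimination of variables by means of $l_1,\dots,l_r$). For every such $\varphi$, the $2\times e$ matrix $X'=\varphi(X)$, whose entries are linear forms of $S'$, satisfies the following. 1. $R'$ is the determinantal ring of $X'$: the map $\varphi$ induces an isomorphism of $k$-algebras $R'\cong S'/I_2(X')$. 2. If some Kronecker–Weierstrass normal form of $X'$ has a scroll block of length $s$, then $X$ has a scroll block of length $t$ for some $t\le s$; if $s\ge1$, then $t$ can be chosen with $1\le t\le s$. -/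

import Mathlib

/-- The ideal `I₂(X)` generated by the `2`-minors of a matrix with two rows. -/
def minorsIdeal {S : Type*} [CommRing S] {e : ℕ} (X : Matrix (Fin 2) (Fin e) S) : Ideal S :=
  Ideal.span (Set.range fun c : Fin e × Fin e => (X.submatrix id ![c.1, c.2]).det)

/-- The determinantal ring `S / I₂(X)`. -/
abbrev DetRing {S : Type*} [CommRing S] {e : ℕ} (X : Matrix (Fin 2) (Fin e) S) : Type _ :=
  S ⧸ minorsIdeal X

/-- The quotient `R / (l₁, …, lᵣ)` of the determinantal ring `R = S / I₂(X)` by the classes of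
elements `l₁, …, lᵣ` of `S`. -/
abbrev DetRingQuot {S : Type*} [CommRing S] {e r : ℕ} (X : Matrix (Fin 2) (Fin e) S)
    (l : Fin r → S) : Type _ :=
  DetRing X ⧸ Ideal.span (Set.range fun i => Ideal.Quotient.mk (minorsIdeal X) (l i))

/-- The three types of Kronecker-Weierstrass blocks; the number is the length of the block. -/
inductive KWBlock (k : Type*) where
  | nilpotent (m : ℕ) : KWBlock k
  | scroll (n : ℕ) : KWBlock k
  | jordan (p : ℕ) (lam : k) : KWBlock k

namespace KWBlock

variable {k : Type*}

/-- Nilpotent and Jordan blocks have length at least one. A scroll block may have length zero: it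
has one variable and no column, and accounts for a variable which does not occur in the matrix. -/
def Proper : KWBlock k → Prop
  | nilpotent m => 1 ≤ m
  | scroll _ => True
  | jordan p _ => 1 ≤ p

/-- The number of columns of a block, which is its length. -/
def cols : KWBlock k → ℕ
  | nilpotent m => m
  | scroll n => n
  | jordan p _ => p

/-- The number of variables of a block. -/
def vars : KWBlock k → ℕ
  | nilpotent m => m - 1
  | scroll n => n + 1
  | jordan p _ => p

/-- A finite family, extended by zero. -/
def extend {S : Type*} [Zero S] {N : ℕ} (y : Fin N → S) (j : ℕ) : S :=
  if h : j < N then y ⟨j, h⟩ else 0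

/-- The `2 × b.cols` matrix of the block `b` on the entries `y`. With `y = (y₁, y₂, …)`:
* nilpotent block of length `m`, first row `0, y₁, …, yₘ₋₁`, second row `y₁, …, yₘ₋₁, 0`;
* scroll block of length `n`, first row `y₁, …, yₙ`, second row `y₂, …, yₙ₊₁`;
* Jordan block of length `p` with eigenvalue `c`, first row `y₁, …, yₚ`,
  second row `y₂ + c y₁, …, yₚ + c yₚ₋₁, c yₚ`. -/
def toMatrix {S : Type*} [CommRing S] [SMul k S] :
    (b : KWBlock k) → (Fin b.vars → S) → Matrix (Fin 2) (Fin b.cols) S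
  | nilpotent _, y => Matrix.of
      ![fun j => if j.val = 0 then 0 else extend y (j.val - 1), fun j => extend y j.val]
  | scroll _, y => Matrix.of
      ![fun j => extend y j.val, fun j => extend y (j.val + 1)]
  | jordan _ c, y => Matrix.of
      ![fun j => extend y j.val, fun j => extend y (j.val + 1) + c • extend y j.val]

end KWBlock

/-- `X` is the Kronecker-Weierstrass matrix with the sequence of blocks `b`: it is the
concatenation of the blocks `b 0, b 1, …`, written in linear forms which together (over all the
blocks) are a `k`-basis of the space of linear forms of `k[x₁, …, xₙ]`. -/
def IsKWMatrix {k : Type*} [Field k] {n e N : ℕ} (b : Fin N → KWBlock k)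
    (X : Matrix (Fin 2) (Fin e) (MvPolynomial (Fin n) k)) : Prop :=
  (∀ i, (b i).Proper) ∧
  ∃ (he : ∑ i, (b i).cols = e) (y : (i : Fin N) → Fin (b i).vars → MvPolynomial (Fin n) k),
    LinearIndependent k (fun p : (Σ i, Fin (b i).vars) => y p.1 p.2) ∧
    Submodule.span k (Set.range fun p : (Σ i, Fin (b i).vars) => y p.1 p.2) =
      MvPolynomial.homogeneousSubmodule (Fin n) k 1 ∧
    ∀ (a : Fin 2) (i : Fin N) (j : Fin (b i).cols),
      X a (Fin.cast he (finSigmaFinEquiv ⟨i, j⟩)) = (b i).toMatrix (y i) a j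

/-- The sequence of blocks `b` is that of a Kronecker-Weierstrass normal form of `X`: an invertible
scalar row operation and an invertible scalar column operation turn `X` into the
Kronecker-Weierstrass matrix with blocks `b` in some basis of the space of linear forms. -/
def IsKWNormalForm {k : Type*} [Field k] {n e N : ℕ} (b : Fin N → KWBlock k)
    (X : Matrix (Fin 2) (Fin e) (MvPolynomial (Fin n) k)) : Prop :=
  ∃ (P : GL (Fin 2) k) (C : GL (Fin e) k),
    IsKWMatrix (n := n) (e := e) b
      ((Matrix.map P.val MvPolynomial.C : Matrix (Fin 2) (Fin 2) (MvPolynomial (Fin n) k)) * X *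
        (Matrix.map C.val MvPolynomial.C : Matrix (Fin e) (Fin e) (MvPolynomial (Fin n) k)))

/-- Some block of `b` is a scroll block of length `s`. -/
def HasScrollBlock {k : Type*} {N : ℕ} (b : Fin N → KWBlock k) (s : ℕ) : Prop :=
  ∃ i, b i = KWBlock.scroll s

/-- `φ` presents `k[x₁, …, xₙ] / (l₁, …, lᵣ)` as the polynomial ring `k[x₁, …, xₙ']`, sending
linear forms to linear forms; that is, `φ` eliminates variables by means of `l₁, …, lᵣ`. -/
structure IsLinearElimination {k : Type*} [Field k] {n n' r : ℕ}
    (l : Fin r → MvPolynomial (Fin n) k)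
    (φ : MvPolynomial (Fin n) k →ₐ[k] MvPolynomial (Fin n') k) : Prop where
  linear : ∀ i, (φ (MvPolynomial.X i)).IsHomogeneous 1
  surjective : Function.Surjective φ
  ker_eq : RingHom.ker φ = Ideal.span (Set.range l)

/-!
A scroll block of length `s` in a normal form of `X'` yields a polynomial null vector of degree at
most `s` of the pencil formed by the two rows of `X'`: send the variables of the block to
`u₀ ^ s, u₀ ^ (s - 1) * u₁, …, u₁ ^ s`, where `u₀, u₁` are the linear polynomials with coefficients
in the rows of the row operation `P`, and all other variables to zero. Composed with `φ`, it is a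
null vector of the pencil of `X`. A nilpotent or a Jordan block has no nonzero null vector, and a
scroll block of length `t` only those which are multiples of `1, T, …, T ^ t`, so some scroll block
of `X` has length at most `s`.
-/

section LinearSubstitution

open MvPolynomial

variable {k σ τ : Type*} [Fintype τ]

section CommSemiring

variable [CommSemiring k]

/-- The linear form `∑ i, v i • X i` with coefficient vector `v`. -/
noncomputable def linearForm : (τ → k) →ₗ[k] MvPolynomial τ k :=
  Fintype.linearCombination k X

theorem linearForm_single [DecidableEq τ] (i : τ) :
    linearForm (Pi.single i 1) = (X i : MvPolynomial τ k) := by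
  simp [linearForm]

theorem range_linearForm : LinearMap.range (linearForm (k := k)) = homogeneousSubmodule τ k 1 := by
  rw [linearForm, Fintype.range_linearCombination, homogeneousSubmodule_one_eq_span_X]

variable [DecidableEq σ]

/-- The substitution which acts on coefficient vectors of linear forms as `f`. -/
noncomputable def linearSubst (f : (σ → k) →ₗ[k] (τ → k)) :
    MvPolynomial σ k →ₐ[k] MvPolynomial τ k :=
  aeval fun i => linearForm (f (Pi.single i 1))

theorem linearSubst_linearForm [Fintype σ] (f : (σ → k) →ₗ[k] (τ → k)) (v : σ → k) :
    linearSubst f (linearForm v) = linearForm (f v) := by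
  have h : (linearSubst f).toLinearMap ∘ₗ linearForm = linearForm ∘ₗ f := by
    ext i : 2
    simp [linearSubst, linearForm_single]
  exact LinearMap.congr_fun h v

theorem linearSubst_X (f : (σ → k) →ₗ[k] (τ → k)) (i : σ) :
    linearSubst f (X i) = linearForm (f (Pi.single i 1)) :=
  aeval_X _ i

theorem linearSubst_linearSubst_of_comp_eq_id [Fintype σ] [DecidableEq τ]
    {f : (σ → k) →ₗ[k] (τ → k)} {g : (τ → k) →ₗ[k] (σ → k)} (hfg : f ∘ₗ g = LinearMap.id)
    (p : MvPolynomial τ k) :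
    linearSubst f (linearSubst g p) = p := by
  have h : (linearSubst f).comp (linearSubst g) = AlgHom.id k (MvPolynomial τ k) := by
    ext1 i
    rw [AlgHom.comp_apply, linearSubst_X, linearSubst_linearForm, ← LinearMap.comp_apply f g, hfg,
      LinearMap.id_apply, linearForm_single, AlgHom.id_apply]
  exact AlgHom.congr_fun h p

end CommSemiring

theorem ker_linearSubst [CommRing k] [Fintype σ] [DecidableEq σ]
    {f : (σ → k) →ₗ[k] (τ → k)} {g : (τ → k) →ₗ[k] (σ → k)} (hfg : f ∘ₗ g = LinearMap.id) :
    RingHom.ker (linearSubst f) = Ideal.span (linearForm '' (LinearMap.ker f : Set (σ → k))) := by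
  classical
  set J := Ideal.span (linearForm '' (LinearMap.ker f : Set (σ → k)))
  have hJ : (Ideal.Quotient.mkₐ k J).comp ((linearSubst g).comp (linearSubst f))
      = Ideal.Quotient.mkₐ k J := by
    ext1 i
    rw [AlgHom.comp_apply, AlgHom.comp_apply, linearSubst_X, linearSubst_linearForm,
      ← linearForm_single i]
    refine Ideal.Quotient.eq.2 ?_
    rw [← map_sub]
    refine Ideal.subset_span ⟨_, ?_, rfl⟩
    rw [SetLike.mem_coe, LinearMap.mem_ker, map_sub, ← LinearMap.comp_apply f g, hfg,
      LinearMap.id_apply, sub_self]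
  refine le_antisymm (fun p hp => ?_) (Ideal.span_le.2 ?_)
  · have h := AlgHom.congr_fun hJ p
    rw [AlgHom.comp_apply, AlgHom.comp_apply, RingHom.mem_ker.1 hp, map_zero, map_zero] at h
    exact Ideal.Quotient.eq_zero_iff_mem.1 h.symm
  · rintro _ ⟨v, hv, rfl⟩
    rw [SetLike.mem_coe, RingHom.mem_ker, linearSubst_linearForm, LinearMap.mem_ker.1 hv, map_zero]

theorem span_linearForm_image_span [CommRing k] {ι : Type*} (c : ι → τ → k) :
    Ideal.span (linearForm '' (Submodule.span k (Set.range c) : Set (τ → k)))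
      = Ideal.span (Set.range fun i => linearForm (c i)) := by
  refine le_antisymm (Ideal.span_le.2 ?_) (Ideal.span_mono ?_)
  · have h : Submodule.span k (Set.range c) ≤
        ((Ideal.span (Set.range fun i => linearForm (c i))).restrictScalars k).comap linearForm :=
      Submodule.span_le.2 (Set.range_subset_iff.2 fun i => Ideal.subset_span ⟨i, rfl⟩)
    exact Set.image_subset_iff.2 h
  · rintro _ ⟨i, rfl⟩
    exact ⟨c i, Submodule.subset_span ⟨i, rfl⟩, rfl⟩

theorem exists_isLinearElimination [Field k] {n r : ℕ} (l : Fin r → MvPolynomial (Fin n) k)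
    (hl : ∀ i, (l i).IsHomogeneous 1) :
    ∃ (n' : ℕ) (φ : MvPolynomial (Fin n) k →ₐ[k] MvPolynomial (Fin n') k),
      IsLinearElimination l φ := by
  have hrange (i : Fin r) : ∃ v, linearForm v = l i := by
    rw [← LinearMap.mem_range, range_linearForm]
    exact hl i
  choose c hc using hrange
  obtain rfl : (fun i => linearForm (c i)) = l := funext hc
  let L : Submodule k (Fin n → k) := Submodule.span k (Set.range c)
  let f : (Fin n → k) →ₗ[k] (Fin (Module.finrank k ((Fin n → k) ⧸ L)) → k) :=
    (Module.finBasis k ((Fin n → k) ⧸ L)).equivFun.toLinearMap ∘ₗ L.mkQ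
  have hker : LinearMap.ker f = L := by
    rw [LinearEquiv.ker_comp, Submodule.ker_mkQ]
  obtain ⟨g, hfg⟩ := f.exists_rightInverse_of_surjective <| LinearMap.range_eq_top.2 <|
    (Module.finBasis k _).equivFun.surjective.comp L.mkQ_surjective
  refine ⟨_, linearSubst f, fun i => ?_,
    fun p => ⟨linearSubst g p, linearSubst_linearSubst_of_comp_eq_id hfg p⟩, ?_⟩
  · rw [linearSubst_X, ← mem_homogeneousSubmodule, ← range_linearForm]
    exact LinearMap.mem_range_self _ _
  · rw [ker_linearSubst hfg, hker, span_linearForm_image_span]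

end LinearSubstitution

section Graded

open MvPolynomial

variable {k σ τ : Type*} [CommSemiring k] {φ : MvPolynomial σ k →ₐ[k] MvPolynomial τ k}

theorem isHomogeneous_algHom_apply (hφ : ∀ i, (φ (X i)).IsHomogeneous 1) {d : ℕ}
    {f : MvPolynomial σ k} (hf : f.IsHomogeneous d) : (φ f).IsHomogeneous d := by
  rw [aeval_unique φ, ← one_mul d]
  exact hf.aeval (φ ∘ X) hφ

theorem homogeneousComponent_algHom_apply (hφ : ∀ i, (φ (X i)).IsHomogeneous 1) (d : ℕ)
    (f : MvPolynomial σ k) :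
    homogeneousComponent d (φ f) = φ (homogeneousComponent d f) := by
  induction f using MvPolynomial.induction_on' with
  | monomial m a =>
    have hm : (monomial m a).IsHomogeneous m.degree := isHomogeneous_monomial a rfl
    rw [homogeneousComponent_of_mem hm,
      homogeneousComponent_of_mem (isHomogeneous_algHom_apply hφ hm), apply_ite φ, map_zero]
  | add p q hp hq => rw [map_add, map_add, map_add, map_add, hp, hq]

theorem IsLinearElimination.exists_linear_preimage {k : Type*} [Field k] {n n' r : ℕ}
    {l : Fin r → MvPolynomial (Fin n) k}
    {φ : MvPolynomial (Fin n) k →ₐ[k] MvPolynomial (Fin n') k} (hφ : IsLinearElimination l φ)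
    {f : MvPolynomial (Fin n') k} (hf : f.IsHomogeneous 1) :
    ∃ p : MvPolynomial (Fin n) k, p.IsHomogeneous 1 ∧ φ p = f := by
  obtain ⟨p, rfl⟩ := hφ.surjective f
  refine ⟨homogeneousComponent 1 p, homogeneousComponent_isHomogeneous 1 p, ?_⟩
  rw [← homogeneousComponent_algHom_apply hφ.linear, homogeneousComponent_of_mem hf, if_pos rfl]

end Graded

section DeterminantalRing

theorem minorsIdeal_map {S S' : Type*} [CommRing S] [CommRing S'] {e : ℕ}
    {F : Type*} [FunLike F S S'] [RingHomClass F S S'] (X : Matrix (Fin 2) (Fin e) S) (φ : F) :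
    minorsIdeal (X.map φ) = (minorsIdeal X).map φ := by
  rw [minorsIdeal, minorsIdeal, Ideal.map_span, ← Set.range_comp]
  congr 2
  funext c
  simp [Matrix.det_fin_two]

theorem exists_algEquiv_of_ker_eq {k S A B : Type*} [CommRing k] [CommRing S] [CommRing A]
    [CommRing B] [Algebra k S] [Algebra k A] [Algebra k B] {p : S →ₐ[k] A} {q : S →ₐ[k] B}
    (hp : Function.Surjective p) (hq : Function.Surjective q)
    (hker : RingHom.ker p = RingHom.ker q) : ∃ ψ : A ≃ₐ[k] B, ∀ f, ψ (p f) = q f := by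
  refine ⟨(Ideal.quotientKerAlgEquivOfSurjective hp).symm.trans
    ((Ideal.quotientEquivAlgOfEq k hker).trans (Ideal.quotientKerAlgEquivOfSurjective hq)),
    fun f => ?_⟩
  have hf : (Ideal.quotientKerAlgEquivOfSurjective hp).symm (p f) = Ideal.Quotient.mk _ f :=
    (AlgEquiv.symm_apply_eq _).2 rfl
  rw [AlgEquiv.trans_apply, hf]
  rfl

theorem exists_detRingQuot_algEquiv {k S S' : Type*} [CommRing k] [CommRing S] [CommRing S']
    [Algebra k S] [Algebra k S'] {e r : ℕ} (X : Matrix (Fin 2) (Fin e) S) (l : Fin r → S)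
    {φ : S →ₐ[k] S'} (hφ : Function.Surjective φ)
    (hker : RingHom.ker φ = Ideal.span (Set.range l)) :
    ∃ ψ : DetRingQuot X l ≃ₐ[k] DetRing (X.map φ),
      ∀ f, ψ (Ideal.Quotient.mk _ (Ideal.Quotient.mk _ f)) = Ideal.Quotient.mk _ (φ f) := by
  let p : S →ₐ[k] DetRingQuot X l := (Ideal.Quotient.mkₐ k _).comp (Ideal.Quotient.mkₐ k _)
  let q : S →ₐ[k] DetRing (X.map φ) := (Ideal.Quotient.mkₐ k _).comp φ
  refine exists_algEquiv_of_ker_eq (p := p) (q := q)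
    (Ideal.Quotient.mk_surjective.comp Ideal.Quotient.mk_surjective)
    (Ideal.Quotient.mk_surjective.comp hφ) ?_
  have hp : RingHom.ker p = minorsIdeal X ⊔ Ideal.span (Set.range l) := by
    rw [← DoubleQuot.ker_quotQuotMk]
    ext f
    simp [RingHom.mem_ker, p, DoubleQuot.quotQuotMk, Ideal.Quotient.eq_zero_iff_mem,
      Ideal.map_span, ← Set.range_comp, Function.comp_def]
  have hq : RingHom.ker q = minorsIdeal X ⊔ RingHom.ker φ := by
    rw [← Ideal.comap_map_of_surjective' φ hφ, ← minorsIdeal_map]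
    ext f
    exact Ideal.Quotient.eq_zero_iff_mem
  rw [hp, hq, hker]

end DeterminantalRing

namespace KWBlock

variable {k S : Type*}

theorem extend_val [Zero S] {N : ℕ} (y : Fin N → S) {j : ℕ} (hj : j < N) :
    extend y j = y ⟨j, hj⟩ :=
  dif_pos hj

theorem extend_of_le [Zero S] {N : ℕ} (y : Fin N → S) {j : ℕ} (hj : N ≤ j) : extend y j = 0 :=
  dif_neg hj.not_gt

theorem eq_zero_of_extend_eq_zero [Zero S] {N : ℕ} {y : Fin N → S} (h : ∀ j, extend y j = 0) :
    y = 0 :=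
  funext fun j => (extend_val y j.isLt).symm.trans (h j)

theorem map_extend {T F : Type*} [Zero S] [Zero T] [FunLike F S T] [ZeroHomClass F S T] (g : F)
    {N : ℕ} (y : Fin N → S) (j : ℕ) : g (extend y j) = extend (g ∘ y) j := by
  unfold extend
  split
  · rfl
  · exact map_zero g

theorem map_toMatrix {T : Type*} [Semiring k] [CommRing S] [CommRing T] [Module k S] [Module k T]
    (g : S →ₗ[k] T) (b : KWBlock k) (y : Fin b.vars → S) (a : Fin 2) (j : Fin b.cols) :
    g (b.toMatrix y a j) = b.toMatrix (g ∘ y) a j := by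
  cases b <;> fin_cases a <;> simp [toMatrix, map_extend, apply_ite g]

theorem toMatrix_zero [Semiring k] [CommRing S] [Module k S] (b : KWBlock k) :
    b.toMatrix (0 : Fin b.vars → S) = 0 := by
  ext a j
  exact (map_toMatrix (0 : S →ₗ[k] S) b 0 a j).symm

theorem toMatrix_mem [Semiring k] [CommRing S] [Module k S] {U : Submodule k S} (b : KWBlock k)
    {y : Fin b.vars → S} (hy : ∀ i, y i ∈ U) (a : Fin 2) (j : Fin b.cols) :
    b.toMatrix y a j ∈ U := by
  have hext (j : ℕ) : extend y j ∈ U := by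
    unfold extend
    split
    · exact hy _
    · exact U.zero_mem
  cases b <;> fin_cases a <;>
    simp [toMatrix, hext, apply_ite (· ∈ U), U.add_mem, U.smul_mem]

theorem toMatrix_scroll_zero [CommRing S] [SMul k S] {s : ℕ} (y : Fin (s + 1) → S) (j : Fin s) :
    (scroll s : KWBlock k).toMatrix y 0 j = y j.castSucc :=
  extend_val y _

theorem toMatrix_scroll_one [CommRing S] [SMul k S] {s : ℕ} (y : Fin (s + 1) → S) (j : Fin s) :
    (scroll s : KWBlock k).toMatrix y 1 j = y j.succ :=
  extend_val y _

theorem toMatrix_geometric [CommRing S] [SMul k S] {b : KWBlock k} {s : ℕ} (hb : b = scroll s)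
    (u : Fin 2 → S) (a : Fin 2) (j : Fin b.cols) :
    b.toMatrix (fun q => u 0 ^ (s - q.val) * u 1 ^ q.val) a j
      = u a * (u 0 ^ (s - 1 - j.val) * u 1 ^ j.val) := by
  subst hb
  have hj : j.val < s := j.isLt
  match a with
  | 0 =>
    refine (toMatrix_scroll_zero _ j).trans ?_
    rw [Fin.val_castSucc, show s - j.val = s - 1 - j.val + 1 by omega, pow_succ', mul_assoc]
  | 1 =>
    refine (toMatrix_scroll_one _ j).trans ?_
    rw [Fin.val_succ, show s - (j.val + 1) = s - 1 - j.val by omega, pow_succ', mul_left_comm]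

theorem toMatrix_ite_geometric [Semiring k] [CommRing S] [Module k S] {b : KWBlock k} {s : ℕ}
    {p : Prop} [Decidable p] (hb : p → b = scroll s) (u : Fin 2 → S) (a : Fin 2)
    (j : Fin b.cols) :
    b.toMatrix (fun q => if p then u 0 ^ (s - q.val) * u 1 ^ q.val else 0) a j
      = u a * if p then u 0 ^ (s - 1 - j.val) * u 1 ^ j.val else 0 := by
  split_ifs with hp
  · exact toMatrix_geometric (hb hp) u a j
  · rw [mul_zero]
    exact congrFun₂ b.toMatrix_zero a j

section Pencil

open Polynomial

variable [CommRing k]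

theorem eq_zero_of_X_mul_toMatrix_nilpotent {m : ℕ} {z : Fin (nilpotent m : KWBlock k).vars → k[X]}
    (hz : ∀ j, X * (nilpotent m).toMatrix z 0 j = (nilpotent m).toMatrix z 1 j) : z = 0 := by
  refine eq_zero_of_extend_eq_zero fun j => ?_
  by_cases hjm : m ≤ j
  · exact extend_of_le z ((Nat.sub_le m 1).trans hjm)
  have h := hz ⟨j, not_le.1 hjm⟩
  induction j with
  | zero => simpa [toMatrix] using h.symm
  | succ j ih =>
    have hj : extend z j = 0 := ih (by omega) (hz _)
    simpa [toMatrix, hj] using h.symm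

theorem eq_zero_of_X_mul_toMatrix_jordan {p : ℕ} {c : k} {z : Fin (jordan p c).vars → k[X]}
    (hz : ∀ j, X * (jordan p c).toMatrix z 0 j = (jordan p c).toMatrix z 1 j) : z = 0 := by
  refine eq_zero_of_extend_eq_zero fun j => ?_
  rcases le_total p j with hpj | hjp
  · exact extend_of_le z hpj
  induction hjp using Nat.decreasingInduction with
  | self => exact extend_of_le z le_rfl
  | of_succ j hj ih =>
    have h : X * extend z j = extend z (j + 1) + c • extend z j := hz ⟨j, hj⟩
    rw [ih, zero_add, smul_eq_C_mul, ← sub_eq_zero, ← sub_mul] at h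
    exact (monic_X_sub_C c).mul_right_eq_zero_iff.1 h

theorem eq_zero_of_X_mul_toMatrix_scroll {t s : ℕ} (hst : s < t) {z : Fin (t + 1) → k[X]}
    (hz : ∀ j, X * (scroll t : KWBlock k).toMatrix z 0 j = (scroll t : KWBlock k).toMatrix z 1 j)
    (hdeg : ∀ j, (z j).natDegree ≤ s) : z = 0 := by
  have hpow (j : Fin (t + 1)) : z j = X ^ j.val * z 0 := by
    induction j using Fin.induction with
    | zero => rw [Fin.val_zero, pow_zero, one_mul]
    | succ j ih =>
      have h : X * z j.castSucc = z j.succ := by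
        simpa only [toMatrix_scroll_zero, toMatrix_scroll_one] using hz j
      rw [← h, ih, Fin.val_castSucc, Fin.val_succ, pow_succ', mul_assoc]
  have hzero : z 0 = 0 := by
    ext i
    have hlast := hdeg (Fin.last t)
    rw [hpow, Fin.val_last] at hlast
    rw [coeff_zero, ← coeff_X_pow_mul _ t i]
    exact coeff_eq_zero_of_natDegree_lt (by omega)
  ext1 j
  rw [hpow j, hzero, mul_zero, Pi.zero_apply]

theorem exists_eq_scroll_of_X_mul_toMatrix {b : KWBlock k} {s : ℕ} {z : Fin b.vars → k[X]}
    (hz : ∀ j, X * b.toMatrix z 0 j = b.toMatrix z 1 j) (hdeg : ∀ j, (z j).natDegree ≤ s)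
    (hne : z ≠ 0) : ∃ t ≤ s, b = scroll t := by
  cases b with
  | nilpotent m => exact absurd (eq_zero_of_X_mul_toMatrix_nilpotent hz) hne
  | jordan p c => exact absurd (eq_zero_of_X_mul_toMatrix_jordan hz) hne
  | scroll t =>
    refine ⟨t, not_lt.1 fun hst => ?_, rfl⟩
    exact hne (eq_zero_of_X_mul_toMatrix_scroll hst hz hdeg)

end Pencil

end KWBlock

section PencilNullVector

open Polynomial

variable {k V W ι : Type*}

/-- A polynomial null vector of degree at most `s` of the pencil `T M₀ - M₁` formed by the rows
`M₀`, `M₁` of a matrix over a module `V`. It is encoded as a linear map `g`, free of a choice of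
basis of `V`: the entries of the null vector are the values of `g` on a basis. -/
structure IsPencilNullVector [CommSemiring k] [AddCommMonoid V] [Module k V]
    (M : Matrix (Fin 2) ι V) (s : ℕ) (g : V →ₗ[k] k[X]) : Prop where
  natDegree_le : ∀ v, (g v).natDegree ≤ s
  X_mul : ∀ j, X * g (M 0 j) = g (M 1 j)

theorem IsPencilNullVector.comp [CommSemiring k] [AddCommMonoid V] [AddCommMonoid W] [Module k V]
    [Module k W] {M : Matrix (Fin 2) ι V} {s : ℕ} {φ : V →ₗ[k] W} {g : W →ₗ[k] k[X]}
    (hg : IsPencilNullVector (M.map φ) s g) : IsPencilNullVector M s (g ∘ₗ φ) :=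
  ⟨fun v => hg.natDegree_le (φ v), hg.X_mul⟩

theorem IsPencilNullVector.exists_eq_scroll [CommRing k] [CommRing V] [Algebra k V]
    {M : Matrix (Fin 2) ι V} {s : ℕ} {g : V →ₗ[k] k[X]} (hg : IsPencilNullVector M s g)
    {b : KWBlock k} {y : Fin b.vars → V} {col : Fin b.cols → ι}
    (hy : ∀ a j, M a (col j) = b.toMatrix y a j) (hne : g ∘ y ≠ 0) :
    ∃ t ≤ s, b = KWBlock.scroll t := by
  have hz (j) : X * b.toMatrix (g ∘ y) 0 j = b.toMatrix (g ∘ y) 1 j := by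
    rw [← KWBlock.map_toMatrix, ← KWBlock.map_toMatrix, ← hy, ← hy, hg.X_mul]
  exact KWBlock.exists_eq_scroll_of_X_mul_toMatrix hz (fun _ => hg.natDegree_le _) hne

end PencilNullVector

theorem exists_linearMap_mem_of_linearIndependent {k V W ι : Type*} [Field k] [AddCommGroup V]
    [Module k V] [AddCommGroup W] [Module k W] {v : ι → V} (hv : LinearIndependent k v)
    {U : Submodule k W} {w : ι → W} (hw : ∀ i, w i ∈ U) :
    ∃ g : V →ₗ[k] W, (∀ i, g (v i) = w i) ∧ ∀ x, g x ∈ U := by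
  let w' : ι → U := fun i => ⟨w i, hw i⟩
  let B := Module.Basis.span hv
  obtain ⟨g, hg⟩ := (B.constr k w').exists_extend
  refine ⟨U.subtype ∘ₗ g, fun i => congrArg Subtype.val (?_ : g (v i) = w' i), fun x => (g x).2⟩
  calc g (v i) = g (B i) := by rw [Module.Basis.span_apply]
    _ = B.constr k w' (B i) := LinearMap.congr_fun hg (B i)
    _ = w' i := B.constr_basis k w' i

namespace IsKWMatrix

variable {k : Type*} [Field k] {n e N s : ℕ} {b : Fin N → KWBlock k}
  {M : Matrix (Fin 2) (Fin e) (MvPolynomial (Fin n) k)}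

theorem exists_columns (hM : IsKWMatrix b M) :
    ∃ (col : (Σ i, Fin (b i).cols) ≃ Fin e)
      (y : (i : Fin N) → Fin (b i).vars → MvPolynomial (Fin n) k),
      LinearIndependent k (fun p : (Σ i, Fin (b i).vars) => y p.1 p.2) ∧
      Submodule.span k (Set.range fun p : (Σ i, Fin (b i).vars) => y p.1 p.2) =
        MvPolynomial.homogeneousSubmodule (Fin n) k 1 ∧
      ∀ i a j, M a (col ⟨i, j⟩) = (b i).toMatrix (y i) a j := by
  obtain ⟨-, he, y, hli, hspan, hy⟩ := hM
  exact ⟨finSigmaFinEquiv.trans (finCongr he), y, hli, hspan, fun i a j => hy a i j⟩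

theorem isHomogeneous (hM : IsKWMatrix b M) (a : Fin 2) (j : Fin e) :
    (M a j).IsHomogeneous 1 := by
  obtain ⟨col, y, -, hspan, hy⟩ := hM.exists_columns
  obtain ⟨⟨i, j⟩, rfl⟩ := col.surjective j
  rw [hy, ← MvPolynomial.mem_homogeneousSubmodule, ← hspan]
  refine (b i).toMatrix_mem (fun q => Submodule.subset_span ?_) a j
  exact Set.mem_range_self (⟨i, q⟩ : Σ i, Fin (b i).vars)

theorem exists_hasScrollBlock_le (hM : IsKWMatrix b M)
    {g : MvPolynomial (Fin n) k →ₗ[k] Polynomial k} (hg : IsPencilNullVector M s g)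
    {f : MvPolynomial (Fin n) k} (hf : f.IsHomogeneous 1) (hgf : g f ≠ 0) :
    ∃ t ≤ s, HasScrollBlock b t := by
  obtain ⟨col, y, -, hspan, hy⟩ := hM.exists_columns
  obtain ⟨i, hi⟩ : ∃ i, g ∘ y i ≠ 0 := by
    by_contra! hzero
    have hle : MvPolynomial.homogeneousSubmodule (Fin n) k 1 ≤ LinearMap.ker g := by
      rw [← hspan, Submodule.span_le, Set.range_subset_iff]
      exact fun p => congrFun (hzero p.1) p.2
    exact hgf (hle hf)
  obtain ⟨t, hts, hb⟩ := hg.exists_eq_scroll (hy i) hi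
  exact ⟨t, hts, i, hb⟩

theorem exists_hasScrollBlock_pos_le (hM : IsKWMatrix b M)
    {g : MvPolynomial (Fin n) k →ₗ[k] Polynomial k} (hg : IsPencilNullVector M s g)
    (hne : M.map g ≠ 0) : ∃ t ≤ s, 1 ≤ t ∧ HasScrollBlock b t := by
  obtain ⟨col, y, -, -, hy⟩ := hM.exists_columns
  obtain ⟨i, ⟨j⟩, hi⟩ : ∃ i, Nonempty (Fin (b i).cols) ∧ g ∘ y i ≠ 0 := by
    by_contra! hzero
    refine hne (Matrix.ext fun a c => ?_)
    obtain ⟨⟨i, j⟩, rfl⟩ := col.surjective c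
    rw [Matrix.map_apply, hy, KWBlock.map_toMatrix, hzero i ⟨j⟩, KWBlock.toMatrix_zero]
    rfl
  obtain ⟨t, hts, hb⟩ := hg.exists_eq_scroll (hy i) hi
  have hcols : (b i).cols = t := by rw [hb]; rfl
  exact ⟨t, hts, by have := j.isLt; omega, i, hb⟩

theorem exists_map_eq_vecMulVec {A : Type*} [CommRing A] [IsDomain A] [Algebra k A]
    (hM : IsKWMatrix b M) (hs : HasScrollBlock b s) {u : Fin 2 → A} (hu : ∀ a, u a ≠ 0)
    {U : Submodule k A} (hU : ∀ q ≤ s, u 0 ^ (s - q) * u 1 ^ q ∈ U) :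
    ∃ g : MvPolynomial (Fin n) k →ₗ[k] A, (∀ f, g f ∈ U) ∧ (∃ w, M.map g = Matrix.vecMulVec u w) ∧
      (∃ f, f.IsHomogeneous 1 ∧ g f ≠ 0) ∧ (1 ≤ s → M.map g ≠ 0) := by
  obtain ⟨i₀, hi₀⟩ := hs
  have hvars : (b i₀).vars = s + 1 := by rw [hi₀]; rfl
  have hcols : (b i₀).cols = s := by rw [hi₀]; rfl
  obtain ⟨col, y, hli, hspan, hy⟩ := hM.exists_columns
  let v : (i : Fin N) → Fin (b i).vars → A := fun i q =>
    if i = i₀ then u 0 ^ (s - q.val) * u 1 ^ q.val else 0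
  have hv (p : Σ i, Fin (b i).vars) : v p.1 p.2 ∈ U := by
    obtain ⟨i, q⟩ := p
    dsimp only [v]
    split_ifs with hi
    · subst hi
      exact hU q (by omega)
    · exact U.zero_mem
  obtain ⟨g, hg, hgU⟩ := exists_linearMap_mem_of_linearIndependent hli hv
  let w : (Σ i, Fin (b i).cols) → A := fun p =>
    if p.1 = i₀ then u 0 ^ (s - 1 - p.2.val) * u 1 ^ p.2.val else 0
  have hgM (a : Fin 2) (p : Σ i, Fin (b i).cols) : g (M a (col p)) = u a * w p := by
    obtain ⟨i, j⟩ := p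
    have hgy : g ∘ y i = v i := funext fun q => hg ⟨i, q⟩
    rw [hy, KWBlock.map_toMatrix, hgy]
    exact KWBlock.toMatrix_ite_geometric (fun hi => hi ▸ hi₀) u a j
  refine ⟨g, hgU, ⟨w ∘ col.symm, ?_⟩, ⟨y i₀ ⟨0, by omega⟩, ?_, ?_⟩, fun hs h => ?_⟩
  · ext a c
    simpa [Matrix.vecMulVec_apply] using hgM a (col.symm c)
  · rw [← MvPolynomial.mem_homogeneousSubmodule, ← hspan]
    exact Submodule.subset_span ⟨⟨i₀, _⟩, rfl⟩
  · rw [hg ⟨i₀, ⟨0, by omega⟩⟩]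
    simpa only [v, if_true, pow_zero, mul_one] using pow_ne_zero _ (hu 0)
  · have h0 := congrFun₂ h 0 (col ⟨i₀, ⟨0, by omega⟩⟩)
    rw [Matrix.map_apply, hgM] at h0
    simp [w, hu] at h0

end IsKWMatrix

section ScalarOperations

open Matrix

theorem algebraMap_mul_mul_algebraMap_map {k A B m ι : Type*} [CommSemiring k] [Semiring A]
    [Semiring B] [Algebra k A] [Algebra k B] [Fintype m] [Fintype ι] (g : A →ₗ[k] B)
    (P : Matrix m m k) (M : Matrix m ι A) (D : Matrix ι ι k) :
    (P.map (algebraMap k A) * M * D.map (algebraMap k A)).map g =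
      P.map (algebraMap k B) * M.map g * D.map (algebraMap k B) := by
  ext a j
  simp [Matrix.mul_apply, ← Algebra.smul_def, ← Algebra.commutes]

theorem exists_eq_vecMulVec_of_mul_mul_eq {R m ι : Type*} [CommRing R] [Fintype m] [DecidableEq m]
    [Fintype ι] [DecidableEq ι] (P : GL m R) (D : GL ι R) {M : Matrix m ι R} {v : m → R}
    {w : ι → R} (h : P.val * M * D.val = vecMulVec (P.val *ᵥ v) w) :
    ∃ w', M = vecMulVec v w' := by
  refine ⟨w ᵥ* D⁻¹.val, ?_⟩
  calc M = P⁻¹.val * (P.val * M * D.val) * D⁻¹.val := by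
        simp [Matrix.mul_assoc]
    _ = vecMulVec v (w ᵥ* D⁻¹.val) := by
        rw [h, mul_vecMulVec, vecMulVec_mul, mulVec_mulVec]
        simp

end ScalarOperations

section LinearRows

open Polynomial Matrix

theorem mulVec_one_X_apply {k m : Type*} [CommSemiring k] (P : Matrix m (Fin 2) k) (a : m) :
    (P.map (algebraMap k k[X]) *ᵥ ![1, X]) a = C (P a 1) * X + C (P a 0) := by
  simp [mulVec, dotProduct, Fin.sum_univ_two, add_comm]

theorem mulVec_one_X_ne_zero {k : Type*} [Field k] (P : GL (Fin 2) k) (a : Fin 2) :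
    (P.val.map (algebraMap k k[X]) *ᵥ ![1, X]) a ≠ 0 := by
  intro h
  rw [mulVec_one_X_apply] at h
  have h0 : P.val a 0 = 0 := by simpa using congrArg (coeff · 0) h
  have h1 : P.val a 1 = 0 := by simpa using congrArg (coeff · 1) h
  refine P.det_ne_zero (det_eq_zero_of_row_eq_zero a fun j => ?_)
  fin_cases j <;> assumption

end LinearRows

namespace IsKWNormalForm

open Polynomial Matrix

theorem exists_isPencilNullVector {k : Type*} [Field k] {n e N s : ℕ} {b : Fin N → KWBlock k}
    {M : Matrix (Fin 2) (Fin e) (MvPolynomial (Fin n) k)} (hM : IsKWNormalForm b M)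
    (hs : HasScrollBlock b s) :
    ∃ g : MvPolynomial (Fin n) k →ₗ[k] k[X], IsPencilNullVector M s g ∧
      (∃ f, f.IsHomogeneous 1 ∧ g f ≠ 0) ∧ (1 ≤ s → M.map g ≠ 0) := by
  obtain ⟨P, D, hKW⟩ := hM
  let u : Fin 2 → k[X] := P.val.map (algebraMap k k[X]) *ᵥ ![1, X]
  have hu (a) : (u a).natDegree ≤ 1 := by
    rw [show u a = _ from mulVec_one_X_apply _ _]
    exact natDegree_linear_le
  have hU (q) (hq : q ≤ s) : u 0 ^ (s - q) * u 1 ^ q ∈ degreeLE k s := by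
    rw [mem_degreeLE, ← natDegree_le_iff_degree_le]
    calc (u 0 ^ (s - q) * u 1 ^ q).natDegree ≤ (s - q) * 1 + q * 1 :=
          natDegree_mul_le_of_le (natDegree_pow_le_of_le _ (hu 0)) (natDegree_pow_le_of_le _ (hu 1))
      _ = s := by omega
  obtain ⟨g, hgU, ⟨w, hw⟩, hlin, hpos⟩ :=
    hKW.exists_map_eq_vecMulVec hs (mulVec_one_X_ne_zero P) hU
  have hmap := algebraMap_mul_mul_algebraMap_map g P.val M D.val
  obtain ⟨w', hw'⟩ := exists_eq_vecMulVec_of_mul_mul_eq (P.map (algebraMap k k[X]))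
    (D.map (algebraMap k k[X])) (hmap.symm.trans hw)
  refine ⟨g, ⟨fun f => natDegree_le_iff_degree_le.2 (mem_degreeLE.1 (hgU f)), fun j => ?_⟩, hlin,
    fun hs1 h0 => hpos hs1 ?_⟩
  · have h0 : g (M 0 j) = 1 * w' j := congrFun₂ hw' 0 j
    have h1 : g (M 1 j) = X * w' j := congrFun₂ hw' 1 j
    rw [h0, h1, one_mul]
  · exact hmap.trans (by rw [h0, Matrix.mul_zero, Matrix.zero_mul])

end IsKWNormalForm

theorem IsLinearElimination.exists_hasScrollBlock_le {k : Type*} [Field k] {n n' e N N' r s : ℕ}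
    {X : Matrix (Fin 2) (Fin e) (MvPolynomial (Fin n) k)} {b : Fin N → KWBlock k}
    {l : Fin r → MvPolynomial (Fin n) k} {φ : MvPolynomial (Fin n) k →ₐ[k] MvPolynomial (Fin n') k}
    (hφ : IsLinearElimination l φ) (hX : IsKWMatrix b X) {b' : Fin N' → KWBlock k}
    (hX' : IsKWNormalForm b' (X.map φ)) (hs : HasScrollBlock b' s) :
    ∃ t ≤ s, HasScrollBlock b t ∧ (1 ≤ s → 1 ≤ t) := by
  obtain ⟨g, hg, ⟨f', hf', hgf'⟩, hne⟩ := hX'.exists_isPencilNullVector hs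
  have hgφ : IsPencilNullVector X s (g ∘ₗ φ.toLinearMap) := hg.comp
  by_cases hs1 : 1 ≤ s
  · obtain ⟨t, hts, ht, hbt⟩ := hX.exists_hasScrollBlock_pos_le hgφ (hne hs1)
    exact ⟨t, hts, hbt, fun _ => ht⟩
  · obtain ⟨f, hf, rfl⟩ := hφ.exists_linear_preimage hf'
    obtain ⟨t, hts, hbt⟩ := hX.exists_hasScrollBlock_le hgφ hf hgf'
    exact ⟨t, hts, hbt, fun h => absurd h hs1⟩

theorem proposition3p2_general {k : Type*} [Field k] {n e N r : ℕ}
    (X : Matrix (Fin 2) (Fin e) (MvPolynomial (Fin n) k))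
    (b : Fin N → KWBlock k) (hX : IsKWMatrix b X)
    (l : Fin r → MvPolynomial (Fin n) k) (hl : ∀ i, (l i).IsHomogeneous 1) :
    (∃ (n' : ℕ) (φ : MvPolynomial (Fin n) k →ₐ[k] MvPolynomial (Fin n') k),
      IsLinearElimination l φ) ∧
    ∀ (n' : ℕ) (φ : MvPolynomial (Fin n) k →ₐ[k] MvPolynomial (Fin n') k),
      IsLinearElimination l φ →
      ∀ X' : Matrix (Fin 2) (Fin e) (MvPolynomial (Fin n') k), X' = X.map φ →
        (∀ a j, (X' a j).IsHomogeneous 1) ∧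
        (∃ ψ : DetRingQuot X l ≃ₐ[k] DetRing X',
          ∀ f, ψ (Ideal.Quotient.mk _ (Ideal.Quotient.mk _ f)) = Ideal.Quotient.mk _ (φ f)) ∧
        ∀ (N' : ℕ) (b' : Fin N' → KWBlock k), IsKWNormalForm b' X' →
          ∀ s, HasScrollBlock b' s →
            ∃ t ≤ s, HasScrollBlock b t ∧ (1 ≤ s → 1 ≤ t) := by
  refine ⟨exists_isLinearElimination l hl, ?_⟩
  rintro n' φ hφ _ rfl
  exact ⟨fun a j => isHomogeneous_algHom_apply hφ.linear (hX.isHomogeneous a j),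
    exists_detRingQuot_algEquiv X l hφ.surjective hφ.ker_eq,
    fun _ _ hX' _ hs => hφ.exists_hasScrollBlock_le hX hX' hs⟩

theorem proposition3p2 {k : Type*} [Field k] [IsAlgClosed k] [CharZero k] {n e N r : ℕ}
    (X : Matrix (Fin 2) (Fin e) (MvPolynomial (Fin n) k))
    (b : Fin N → KWBlock k) (hX : IsKWMatrix b X)
    (l : Fin r → MvPolynomial (Fin n) k) (hl : ∀ i, (l i).IsHomogeneous 1) :
    (∃ (n' : ℕ) (φ : MvPolynomial (Fin n) k →ₐ[k] MvPolynomial (Fin n') k),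
      IsLinearElimination l φ) ∧
    ∀ (n' : ℕ) (φ : MvPolynomial (Fin n) k →ₐ[k] MvPolynomial (Fin n') k),
      IsLinearElimination l φ →
      ∀ X' : Matrix (Fin 2) (Fin e) (MvPolynomial (Fin n') k), X' = X.map φ →
        (∀ a j, (X' a j).IsHomogeneous 1) ∧
        (∃ ψ : DetRingQuot X l ≃ₐ[k] DetRing X',
          ∀ f, ψ (Ideal.Quotient.mk _ (Ideal.Quotient.mk _ f)) = Ideal.Quotient.mk _ (φ f)) ∧
        ∀ (N' : ℕ) (b' : Fin N' → KWBlock k), IsKWNormalForm b' X' →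
          ∀ s, HasScrollBlock b' s →
            ∃ t ≤ s, HasScrollBlock b t ∧ (1 ≤ s → 1 ≤ t) :=
  proposition3p2_general X b hX l hl
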